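/- Let $V$ be a finite dataset of $N$ points and let $R$ be any nonempty set of distance functions $\rho:V\times V\to\mathbb{R}$ (arbitrary real functions; for example all functions, or all metrics). Each $\rho\in R$ defines the classifier $h_\rho:V^3\to\{-1,1\}$ with $h_\rho(x,y,z)=-1$ if $\rho(x,y)<\rho(x,z)$ and $h_\rho(x,y,z)=1$ otherwise; put $\mathcal{H}=\{h_\rho:\rho\in R\}$. Nasty noise of rate $\eta$: for a target $h^*\in\mathcal{H}$, a distribution $\mathcal{D}$ on $V^3$ and a sample size $n$, an adversary with full knowledge of the learner, of $h^*$ and of $\mathcal{D}$ draws $n$ i.i.d. triples from $\mathcal{D}$, labels them by $h^*$, chooses $m$ of the $n$ positions, where $m$ has distribution $\mathrm{Bin}(n,\eta)$ (the choice may depend on the sample drawn), replaces the examples there by arbitrary labelled triples, and gives the resulting sample to the learner. An algorithm using $n$ examples learns $\mathcal{H}$ with accuracy $\epsilon$ and confidence $\delta$ if it always outputs some $h\in\mathcal{H}$ and, for every $h^*\in\mathcal{H}$, every $\mathcal{D}$ and every such adversary, $\Pr_{(x,y,z)\sim\mathcal{D}}[h(x,y,z)\ne h^*(x,y,z)]<\epsilon$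 with probability at least $1-\delta$. The sample complexity $n(\epsilon,\delta)$ is the least $n$ for which such an algorithm exists. Theorem. There is a universal constant $C>0$ such that for all $V$, $N$, $R$ as above, all $0<\eta\le 1$, $\Delta>0$ and $0<\delta<1$, the sample complexity with accuracy $\epsilon=2\eta+\Delta$ in the presence of nasty noise of rate $\eta$ is finite and satisfies $$n(2\eta+\Delta,\delta)\le \frac{C}{\Delta^2}\Bigl(N^2+\log\frac1\delta\Bigr),$$ and moreover, for every $n\ge \frac{C}{\Delta^2}\bigl(N^2+\log\frac1\delta\bigr)$ there is an algorithm using $n$ examples that learns $\mathcal{H}$ with accuracy $2\eta+\Delta$ and confidence $\delta$ in the presence of nasty noise of rate $\eta$. -/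

import Mathlib

open scoped ENNReal

noncomputable section

/-- The contrastive classifier of a distance function `ρ` on a dataset `V`.  On a triple `(x, y, z)`
the value `false` (sign `-1`, label `(x, y⁺, z⁻)`) means `ρ x y < ρ x z`; in every other case the
value is `true` (sign `1`, label `(x, y⁻, z⁺)`). -/
def contrastiveHyp {V : Type*} (ρ : V → V → ℝ) : V × V × V → Bool :=
  fun t => decide (ρ t.1 t.2.2 ≤ ρ t.1 t.2.1)

/-- The hypothesis class induced by a family `R` of distance functions. -/
def contrastiveClass {V : Type*} (R : Set (V → V → ℝ)) : Set (V × V × V → Bool) :=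
  contrastiveHyp '' R

/-- The error of `h` against the target `hstar`: the `D`-probability that they disagree. -/
def classificationError {α : Type*} (D : PMF α) (h hstar : α → Bool) : ℝ≥0∞ :=
  D.toOuterMeasure {x | h x ≠ hstar x}

/-- A nasty adversary of rate `η` for samples of size `n`, given by the joint law of a triple
`(S', T, S)`: the sample `S'` it draws, the set `T` of positions it chooses, and the labelled
sample `S` that it hands to the learner.  The sample is i.i.d. from `D`, the number of chosen
positions is binomial, and the positions that are not chosen stay as they are, with their correct
labels.  Nothing else is required: `T` may depend on `S'` (and on extra randomness), and the
examples at the positions of `T` are replaced by arbitrary labelled examples. -/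
structure IsNastyAdversary {α : Type*} (D : PMF α) (hstar : α → Bool) (η : unitInterval) (n : ℕ)
    (law : PMF ((Fin n → α) × Finset (Fin n) × (Fin n → α × Bool))) : Prop where
  iid_sample : ∀ s : Fin n → α, law.map (fun ω => ω.1) s = ∏ i, D (s i)
  card_binomial :
    (law.map (fun ω => ω.2.1.card)).toMeasure = ProbabilityTheory.binomial n η
  unchanged : ∀ ω ∈ law.support, ∀ i, i ∉ ω.2.1 → ω.2.2 i = (ω.1 i, hstar (ω.1 i))

/-- The algorithm `A`, which sees `n` labelled examples and outputs a classifier, PAC learns the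
class `H` with nasty noise of rate `η`, accuracy `ε` and confidence `δ`: its outputs are in `H`,
and for all targets in `H`, all distributions and all nasty adversaries, the error is smaller than
`ε` with probability at least `1 - δ`. -/
def NastyPACLearns {α : Type*} (H : Set (α → Bool)) (η : unitInterval) (ε δ : ℝ) (n : ℕ)
    (A : (Fin n → α × Bool) → (α → Bool)) : Prop :=
  (∀ S, A S ∈ H) ∧
    ∀ hstar ∈ H, ∀ (D : PMF α) (law : PMF ((Fin n → α) × Finset (Fin n) × (Fin n → α × Bool))),
      IsNastyAdversary D hstar η n law →
        ENNReal.ofReal (1 - δ) ≤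
          law.toOuterMeasure
            {ω | classificationError D (A ω.2.2) hstar < ENNReal.ofReal ε}

/-- The sample complexity: the least `n` for which some algorithm that uses `n` examples PAC learns
`H` with nasty noise (`⊤` if there is none). -/
def nastySampleComplexity {α : Type*} (H : Set (α → Bool)) (η : unitInterval) (ε δ : ℝ) : ℕ∞ :=
  ⨅ (n : ℕ) (_ : ∃ A, NastyPACLearns H η ε δ n A), (n : ℕ∞)

end

/-! The learner is empirical risk minimization over the finite class. If `T` is the set of corrupted
positions, the target errs at most `|T|` times on the corrupted sample, so the minimizer errs at
most `2|T|` times on the clean one. By a Chernoff bound, `|T| < n(η + Δ/4)` with high probability,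
which leaves a slack of `Δ/2` for the gap between empirical and true error. The two unlikely events
are joined by a union bound, so the adversary may choose `T` depending on the sample.

The gap must be controlled uniformly over disagreement sets from `O((d + log(1/δ))/Δ²)` examples,
with no factor `log(1/Δ)`. Hence chaining replaces a single union bound: Dudley's packing bound
(`log_card_le_of_separated`) gives nets at scales `4⁻ᵏ`, `sum_exp_signSum_selection_le` sums their
costs into an exponential moment, and symmetrization with a ghost sample (`sum_prod_deviation_le`)
turns this into a tail bound.

Finally `d ≤ |V|²`, since a contrastive label is the sign of a linear functional of `ρ ∈ ℝ^(V × V)`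
(`vcDim_disagreements_contrastiveClass_le`). -/

/-! ### Packing numbers and VC dimension -/

section Packing

open Finset

/-- **Sauer–Shelah** in generating-function form. -/
theorem card_mul_pow_le_of_vcDim_le {ι : Type*} [Fintype ι] [DecidableEq ι]
    {P : Finset (Finset ι)} {d : ℕ} (hd : P.vcDim ≤ d) {x : ℝ} (hx : 0 ≤ x) (hx1 : x ≤ 1) :
    (#P : ℝ) * x ^ d ≤ (1 + x) ^ Fintype.card ι := by
  calc (#P : ℝ) * x ^ d ≤ #P.shatterer * x ^ d := by
        have := P.card_le_card_shatterer
        gcongr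
    _ = ∑ _s ∈ P.shatterer, x ^ d := by simp
    _ ≤ ∑ s ∈ P.shatterer, x ^ #s := by
        refine sum_le_sum fun s hs => pow_le_pow_of_le_one hx hx1 ?_
        exact (mem_shatterer.1 hs).card_le_vcDim.trans hd
    _ ≤ ∑ s ∈ (univ : Finset ι).powerset, x ^ #s :=
        sum_le_sum_of_subset_of_nonneg (by intro s _; simp) fun _ _ _ => by positivity
    _ = (1 + x) ^ Fintype.card ι := by
        have := sum_pow_mul_eq_add_pow x 1 (univ : Finset ι)
        simpa [add_comm] using this

/-- Pulling a set family back along a map does not increase its VC dimension. -/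
theorem vcDim_image_preimage_le {ι κ : Type*} [DecidableEq ι] [Fintype κ] [DecidableEq κ]
    (P : Finset (Finset ι)) (g : κ → ι) :
    (P.image fun A => univ.filter fun j => g j ∈ A).vcDim ≤ P.vcDim := by
  refine Finset.sup_le fun s hs => ?_
  rw [mem_shatterer] at hs
  -- Points with the same image under `g` lie in the same pulled-back sets, so no trace can isolate
  -- one of them.
  have hinj : Set.InjOn g s := by
    intro a ha b hb hab
    by_contra hne
    obtain ⟨u, hu, hua⟩ := hs.exists_inter_eq_singleton (Finset.mem_coe.1 ha)
    obtain ⟨A, -, rfl⟩ := mem_image.1 hu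
    have h1 : a ∈ s ∩ univ.filter fun j => g j ∈ A := by simp [hua]
    have h2 : b ∈ s ∩ univ.filter fun j => g j ∈ A := by
      simp only [mem_inter, mem_filter, mem_univ, true_and] at h1 ⊢
      exact ⟨hb, hab ▸ h1.2⟩
    rw [hua, mem_singleton] at h2
    exact hne h2.symm
  rw [← card_image_of_injOn hinj]
  refine Shatters.card_le_vcDim fun t ht => ?_
  obtain ⟨u, hu, hut⟩ := hs (filter_subset (fun j => g j ∈ t) s)
  obtain ⟨A, hA, rfl⟩ := mem_image.1 hu
  refine ⟨A, hA, ?_⟩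
  ext y
  constructor
  · intro hy
    obtain ⟨hy1, hy2⟩ := mem_inter.1 hy
    obtain ⟨j, hj, rfl⟩ := mem_image.1 hy1
    have : j ∈ s ∩ univ.filter fun j => g j ∈ A := by simp [hj, hy2]
    rw [hut] at this
    exact (mem_filter.1 this).2
  · intro hy
    obtain ⟨j, hj, rfl⟩ := mem_image.1 (ht hy)
    have : j ∈ s.filter fun j => g j ∈ t := by simp [hj, hy]
    rw [← hut] at this
    have h2 := (mem_inter.1 this).2
    simp only [mem_filter, mem_univ, true_and] at h2
    exact mem_inter.2 ⟨ht hy, h2⟩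

/-- A few points suffice to tell apart the members of a separated family. -/
theorem exists_separating_sample {ι : Type*} [Fintype ι] [DecidableEq ι] [Nonempty ι]
    {P : Finset (Finset ι)} (hP : P.Nonempty) {ε : ℝ}
    (hsep : ∀ A ∈ P, ∀ B ∈ P, A ≠ B → ε * Fintype.card ι ≤ #(symmDiff A B))
    {m : ℕ} (hm : (#P : ℝ) ^ 2 * Real.exp (-ε * m) ≤ 1) :
    ∃ g : Fin m → ι, ∀ A ∈ P, ∀ B ∈ P, A ≠ B → ∃ j, g j ∈ symmDiff A B := by
  by_contra! hcon
  set n := Fintype.card ι with hn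
  have hn0 : (0 : ℝ) < n := by exact_mod_cast Fintype.card_pos
  -- Union bound by counting: a sample that fails misses `symmDiff A B` for some pair, and at most
  -- `(n * exp (-ε)) ^ m` samples miss a given one.
  have hcover : (univ : Finset (Fin m → ι)) ⊆
      P.offDiag.biUnion fun p => Fintype.piFinset fun _ => (symmDiff p.1 p.2)ᶜ := by
    intro g _
    obtain ⟨A, hA, B, hB, hAB, h⟩ := hcon g
    refine mem_biUnion.2 ⟨(A, B), mem_offDiag.2 ⟨hA, hB, hAB⟩, ?_⟩
    simpa only [Fintype.mem_piFinset, mem_compl] using h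
  have h1 : (n : ℝ) ^ m ≤ ∑ p ∈ P.offDiag, ((n : ℝ) * Real.exp (-ε)) ^ m := by
    have h2 := (card_le_card hcover).trans card_biUnion_le
    have h3 : (n : ℝ) ^ m ≤ ∑ p ∈ P.offDiag,
        (#(Fintype.piFinset fun _ : Fin m => (symmDiff p.1 p.2)ᶜ) : ℝ) := by
      have h4 : ((#(univ : Finset (Fin m → ι)) : ℕ) : ℝ) ≤ _ := Nat.cast_le.2 h2
      simpa [hn] using h4
    refine h3.trans (sum_le_sum fun p hp => ?_)
    obtain ⟨hA, hB, hAB⟩ := mem_offDiag.1 hp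
    have h5 := hsep _ hA _ hB hAB
    rw [Fintype.card_piFinset]
    simp only [prod_const, card_univ, Fintype.card_fin]
    push_cast
    refine pow_le_pow_left₀ (by positivity) ?_ _
    have h6 := card_compl_add_card (symmDiff p.1 p.2)
    have h7 : (#((symmDiff p.1 p.2)ᶜ) : ℝ) + #(symmDiff p.1 p.2) = n := by exact_mod_cast h6
    have h8 := Real.add_one_le_exp (-ε)
    nlinarith
  rw [sum_const, nsmul_eq_mul, mul_pow, ← Real.exp_nat_mul] at h1
  have hM : (0 : ℝ) < #P := by exact_mod_cast hP.card_pos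
  have h9 : (#P.offDiag : ℝ) < (#P : ℝ) ^ 2 := by
    rw [offDiag_card, Nat.cast_sub (Nat.le_mul_self _)]
    push_cast
    nlinarith
  have h10 : (#P.offDiag : ℝ) * Real.exp (m * -ε) < 1 := by
    refine lt_of_lt_of_le (mul_lt_mul_of_pos_right h9 (Real.exp_pos _)) ?_
    rwa [mul_comm (m : ℝ)]
  have h11 : (0 : ℝ) < (n : ℝ) ^ m := by positivity
  nlinarith

/-- **Dudley's packing bound** for separated families of bounded VC dimension. -/
theorem log_card_le_of_separated {ι : Type*} [Fintype ι] [DecidableEq ι] [Nonempty ι]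
    {P : Finset (Finset ι)} (hP : P.Nonempty) {d : ℕ} (hd : P.vcDim ≤ d) {ε : ℝ}
    (hε : 0 < ε) (hε1 : ε ≤ 1)
    (hsep : ∀ A ∈ P, ∀ B ∈ P, A ≠ B → ε * Fintype.card ι ≤ #(symmDiff A B)) :
    Real.log #P ≤ 4 / 3 * (d * Real.log (8 / ε) + 1 / 8) := by
  have hM : (0 : ℝ) < #P := by exact_mod_cast hP.card_pos
  have hM1 : (1 : ℝ) ≤ #P := by exact_mod_cast hP.card_pos
  have hlog := Real.log_nonneg hM1
  set m := ⌈2 * Real.log #P / ε⌉₊ with hmdef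
  have hm1 : 2 * Real.log #P / ε ≤ m := Nat.le_ceil _
  have hm2 : (m : ℝ) < 2 * Real.log #P / ε + 1 := Nat.ceil_lt_add_one (by positivity)
  have hm : (#P : ℝ) ^ 2 * Real.exp (-ε * m) ≤ 1 := by
    have h1 : 2 * Real.log #P ≤ ε * m := by
      rw [div_le_iff₀ hε] at hm1; linarith
    calc (#P : ℝ) ^ 2 * Real.exp (-ε * m)
        = Real.exp (2 * Real.log #P + -ε * m) := by
          rw [Real.exp_add, two_mul, Real.exp_add, Real.exp_log hM, sq]
      _ ≤ 1 := Real.exp_le_one_iff.2 (by linarith)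
  obtain ⟨g, hg⟩ := exists_separating_sample hP hsep hm
  set Q := P.image fun A => univ.filter fun j => g j ∈ A with hQ
  have hcard : #Q = #P := by
    refine card_image_of_injOn fun A hA B hB hAB => ?_
    by_contra hne
    obtain ⟨j, hj⟩ := hg A hA B hB hne
    have h1 : j ∈ univ.filter (fun j => g j ∈ A) ↔ j ∈ univ.filter (fun j => g j ∈ B) := by
      exact iff_of_eq (congrArg (j ∈ ·) hAB)
    simp only [mem_filter, mem_univ, true_and] at h1
    rw [mem_symmDiff] at hj
    tauto
  have hvc := (vcDim_image_preimage_le P g).trans hd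
  -- Since `m` is about `2 log #P / ε`, the choice `x = ε / 8` makes the right side at most `exp
  -- (log #P / 4 + 1 / 8)`. Absorbing the quarter on the left gives the factor `4 / 3`.
  have h1 := card_mul_pow_le_of_vcDim_le hvc (x := ε / 8) (by positivity) (by linarith)
  rw [← hQ, hcard, Fintype.card_fin] at h1
  have h2 : (1 + ε / 8) ^ m ≤ Real.exp (m * (ε / 8)) := by
    rw [Real.exp_nat_mul]
    refine pow_le_pow_left₀ (by positivity) ?_ _
    linarith [Real.add_one_le_exp (ε / 8)]
  have h3 := Real.log_le_log (by positivity) (h1.trans h2)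
  rw [Real.log_exp, Real.log_mul (by positivity) (by positivity), Real.log_pow] at h3
  have h4 : Real.log (ε / 8) = -Real.log (8 / ε) := by rw [← Real.log_inv, inv_div]
  rw [h4] at h3
  have h5 : m * (ε / 8) ≤ Real.log #P / 4 + 1 / 8 := by
    have : m * ε ≤ 2 * Real.log #P + ε := by
      have := mul_le_mul_of_nonneg_right hm2.le hε.le
      rwa [add_mul, div_mul_cancel₀ _ hε.ne', one_mul] at this
    linarith
  linarith

/-- Maximal separated subfamilies are nets. -/
theorem exists_separated_net {ι : Type*} [DecidableEq ι] (F : Finset (Finset ι)) (r : ℝ) :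
    ∃ N ⊆ F, (∀ A ∈ N, ∀ B ∈ N, A ≠ B → r ≤ #(symmDiff A B)) ∧
      ∀ A ∈ F, ∃ B ∈ N, (#(symmDiff A B) : ℝ) ≤ r ∨ A = B := by
  classical
  set S := F.powerset.filter fun N => ∀ A ∈ N, ∀ B ∈ N, A ≠ B → r ≤ #(symmDiff A B) with hS
  obtain ⟨N, hN, hmax⟩ := exists_max_image S card ⟨∅, by simp [hS]⟩
  simp only [hS, mem_filter, mem_powerset] at hN hmax
  refine ⟨N, hN.1, hN.2, fun A hA => ?_⟩
  by_contra! hcon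
  have hAN : A ∉ N := fun h => (hcon A h).2 rfl
  have := hmax (insert A N) ⟨insert_subset hA hN.1, ?_⟩
  · rw [card_insert_of_notMem hAN] at this
    omega
  · intro B hB C hC hBC
    rcases mem_insert.1 hB with hB' | hB' <;> rcases mem_insert.1 hC with hC' | hC'
    · exact absurd (hB'.trans hC'.symm) hBC
    · rw [hB']; exact (hcon C hC').1.le
    · rw [symmDiff_comm, hC']; exact (hcon B hB').1.le
    · exact hN.2 B hB' C hC' hBC

/-- Nets of all dyadic scales for a family of bounded VC dimension. -/
theorem exists_net_of_vcDim_le {ι : Type*} [Fintype ι] [DecidableEq ι] [Nonempty ι]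
    {F : Finset (Finset ι)} {d : ℕ} (hF : F.vcDim ≤ d) (hd : 1 ≤ d) (k : ℕ) :
    ∃ N : Finset (Finset ι), (#N : ℝ) ≤ Real.exp (3 * d * (k + 1)) ∧
      ∀ A ∈ F, ∃ B ∈ N, (#(symmDiff A B) : ℝ) ≤ (1 / 4) ^ k * Fintype.card ι := by
  obtain ⟨N, hNF, hsep, hnet⟩ := exists_separated_net F ((1 / 4) ^ k * Fintype.card ι)
  refine ⟨N, ?_, fun A hA => ?_⟩
  · rcases N.eq_empty_or_nonempty with rfl | hN
    · simp [Real.exp_nonneg]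
    have h := log_card_le_of_separated hN ((vcDim_mono hNF).trans hF) (ε := (1 / 4) ^ k)
      (by positivity) (pow_le_one₀ (by norm_num) (by norm_num)) hsep
    have hM : (0 : ℝ) < #N := by exact_mod_cast hN.card_pos
    rw [← Real.log_le_iff_le_exp hM]
    refine h.trans ?_
    have h8 : Real.log (8 / (1 / 4) ^ k) = (3 + 2 * k) * Real.log 2 := by
      have : (8 : ℝ) / (1 / 4) ^ k = 2 ^ (3 + 2 * k) := by
        rw [pow_add, pow_mul, one_div, inv_pow, div_inv_eq_mul]
        norm_num
      rw [this, Real.log_pow]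
      push_cast
      ring
    have hl := Real.log_two_lt_d9
    have hd' : (1 : ℝ) ≤ d := by exact_mod_cast hd
    have hk : (0 : ℝ) ≤ k := k.cast_nonneg
    rw [h8]
    -- The constant `3` of the exponent suffices because `4/3 * (3 * 0.7 + 1/8) < 3`; `1 ≤ d`
    -- absorbs the `1/8`.
    have h9 : (d : ℝ) * ((3 + 2 * k) * Real.log 2) ≤ d * ((3 + 2 * k) * 0.7) := by
      gcongr
      linarith
    nlinarith [mul_nonneg (zero_le_one.trans hd') hk]
  · obtain ⟨B, hB, h | rfl⟩ := hnet A hA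
    · exact ⟨B, hB, h⟩
    · exact ⟨A, hB, by simp⟩

end Packing

/-! ### Chaining for the Rademacher process -/

section Chaining

open Finset

/-- The sign of a Boolean. -/
def boolSign (b : Bool) : ℝ := if b then 1 else -1

/-- The sum of the signs `σ` over the set `A`. -/
def signSum {ι : Type*} (σ : ι → Bool) (A : Finset ι) : ℝ := ∑ i ∈ A, boolSign (σ i)

/-- Independence of the signs factors the sum into terms `2 cosh (a i)`, and `cosh x ≤ exp (x² /
2)`. -/
theorem sum_exp_sum_mul_boolSign_le {ι : Type*} [Fintype ι] [DecidableEq ι] (a : ι → ℝ) :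
    ∑ σ : ι → Bool, Real.exp (∑ i, a i * boolSign (σ i)) ≤
      2 ^ Fintype.card ι * Real.exp (∑ i, a i ^ 2 / 2) := by
  have h1 : ∑ σ : ι → Bool, Real.exp (∑ i, a i * boolSign (σ i)) =
      ∏ i, ∑ b : Bool, Real.exp (a i * boolSign b) := by
    rw [Finset.prod_univ_sum, Fintype.piFinset_univ]
    exact sum_congr rfl fun σ _ => Real.exp_sum _ _
  rw [h1, Real.exp_sum, ← card_univ, ← prod_const, ← prod_mul_distrib]
  refine prod_le_prod (fun i _ => by positivity) fun i _ => ?_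
  have := Real.cosh_le_exp_half_sq (a i)
  rw [Real.cosh_eq] at this
  simp [boolSign]
  linarith

theorem sum_exp_signSum_sub_le {ι : Type*} [Fintype ι] [DecidableEq ι] (t : ℝ)
    (A B : Finset ι) :
    ∑ σ : ι → Bool, Real.exp (t * (signSum σ A - signSum σ B)) ≤
      2 ^ Fintype.card ι * Real.exp (t ^ 2 * #(symmDiff A B) / 2) := by
  set a : ι → ℝ := fun i => t * ((if i ∈ A then 1 else 0) - if i ∈ B then 1 else 0) with ha
  have h := sum_exp_sum_mul_boolSign_le a
  have h1 : ∀ σ : ι → Bool, ∑ i, a i * boolSign (σ i) = t * (signSum σ A - signSum σ B) := by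
    intro σ
    simp only [ha, signSum, mul_assoc, ← mul_sum, sub_mul, sum_sub_distrib, ite_mul, one_mul,
      zero_mul, sum_ite_mem, univ_inter]
  have h2 : ∑ i, a i ^ 2 / 2 = t ^ 2 * #(symmDiff A B) / 2 := by
    have : ∀ i, a i ^ 2 / 2 = t ^ 2 / 2 * if i ∈ symmDiff A B then 1 else 0 := by
      intro i
      by_cases h1 : i ∈ A <;> by_cases h2 : i ∈ B <;> simp [ha, h1, h2, mem_symmDiff]
    simp only [this, ← mul_sum, sum_ite_mem, univ_inter, sum_const, nsmul_eq_mul, mul_one]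
    ring
  simpa only [h1, h2] using h

/-- Jensen's inequality with dyadic weights, the leftover weight `(1/2)^K` being put on the value
`0`. It allows the levels of the chain to be bounded separately although they are dependent. -/
theorem exp_dyadic_sum_le (K : ℕ) (u : ℕ → ℝ) :
    Real.exp (∑ k ∈ range K, (1 / 2) ^ (k + 1) * u k) ≤
      (1 / 2) ^ K + ∑ k ∈ range K, (1 / 2) ^ (k + 1) * Real.exp (u k) := by
  induction K generalizing u with
  | zero => simp
  | succ K ih =>
    have h1 := ih fun k => u (k + 1)
    set v := ∑ k ∈ range K, (1 / 2 : ℝ) ^ (k + 1) * u (k + 1) with hv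
    have h2 : ∑ k ∈ range (K + 1), (1 / 2 : ℝ) ^ (k + 1) * u k = 1 / 2 * u 0 + 1 / 2 * v := by
      rw [sum_range_succ', hv, mul_sum, add_comm]
      congr 1
      · ring
      · exact sum_congr rfl fun k _ => by ring
    have h3 : ∑ k ∈ range (K + 1), (1 / 2 : ℝ) ^ (k + 1) * Real.exp (u k) =
        1 / 2 * Real.exp (u 0) +
          1 / 2 * ∑ k ∈ range K, (1 / 2 : ℝ) ^ (k + 1) * Real.exp (u (k + 1)) := by
      rw [sum_range_succ', mul_sum, add_comm]
      congr 1
      · ring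
      · exact sum_congr rfl fun k _ => by ring
    have h4 := convexOn_exp.2 (Set.mem_univ (u 0)) (Set.mem_univ v)
      (by norm_num : (0 : ℝ) ≤ 1 / 2) (by norm_num : (0 : ℝ) ≤ 1 / 2) (by norm_num)
    simp only [smul_eq_mul] at h4
    rw [h2, h3, pow_succ]
    linarith

theorem sum_dyadic_mul_succ_le (K : ℕ) :
    ∑ k ∈ range K, (1 / 2 : ℝ) ^ (k + 1) * (k + 1) ≤ 2 := by
  have h : ∑ k ∈ range K, (1 / 2 : ℝ) ^ (k + 1) * (k + 1) = 2 - (K + 2) * (1 / 2) ^ K := by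
    induction K with
    | zero => simp
    | succ K ih => rw [sum_range_succ, ih]; push_cast; ring
  rw [h]
  have : (0 : ℝ) ≤ (K + 2) * (1 / 2) ^ K := by positivity
  linarith

theorem sum_dyadic_eq (K : ℕ) : ∑ k ∈ range K, (1 / 2 : ℝ) ^ (k + 1) = 1 - (1 / 2) ^ K := by
  induction K with
  | zero => simp
  | succ K ih => rw [sum_range_succ, ih]; ring

/-- The pair `(a σ, b σ)` depends on the signs, so its term is bounded by the sum over all close
pairs. There are at most `exp L` of them, which the shift by `-L` pays for. -/
theorem sum_exp_increment_le {ι : Type*} [Fintype ι] [DecidableEq ι]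
    {P Q : Finset (Finset ι)} {t r L : ℝ} (hcard : (#P : ℝ) * #Q ≤ Real.exp L)
    {a b : (ι → Bool) → Finset ι} (ha : ∀ σ, a σ ∈ P) (hb : ∀ σ, b σ ∈ Q)
    (hab : ∀ σ, (#(symmDiff (a σ) (b σ)) : ℝ) ≤ r) :
    ∑ σ, Real.exp (t * (signSum σ (a σ) - signSum σ (b σ)) - L) ≤
      2 ^ Fintype.card ι * Real.exp (t ^ 2 * r / 2) := by
  set S := (P ×ˢ Q).filter fun AB => (#(symmDiff AB.1 AB.2) : ℝ) ≤ r with hS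
  have hScard : (#S : ℝ) ≤ Real.exp L := by
    refine le_trans ?_ hcard
    have h2 : #S ≤ #P * #Q := by
      rw [← card_product]; exact card_filter_le _ _
    exact_mod_cast h2
  let f : (ι → Bool) → Finset ι × Finset ι → ℝ := fun σ AB =>
    Real.exp (t * (signSum σ AB.1 - signSum σ AB.2))
  have h1 : ∀ σ, Real.exp (t * (signSum σ (a σ) - signSum σ (b σ)) - L) ≤
      Real.exp (-L) * ∑ AB ∈ S, f σ AB := by
    intro σ
    have hmem : (a σ, b σ) ∈ S := mem_filter.2 ⟨mem_product.2 ⟨ha σ, hb σ⟩, hab σ⟩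
    rw [sub_eq_add_neg, add_comm, Real.exp_add]
    exact mul_le_mul_of_nonneg_left
      (single_le_sum (f := f σ) (fun _ _ => Real.exp_nonneg _) hmem) (Real.exp_nonneg _)
  have h2 : ∀ AB ∈ S, ∑ σ, f σ AB ≤ 2 ^ Fintype.card ι * Real.exp (t ^ 2 * r / 2) := by
    intro AB hAB
    refine (sum_exp_signSum_sub_le _ _ _).trans ?_
    have h4 := (mem_filter.1 hAB).2
    gcongr
  calc _ ≤ ∑ σ, Real.exp (-L) * ∑ AB ∈ S, f σ AB := sum_le_sum fun σ _ => h1 σ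
    _ = Real.exp (-L) * ∑ AB ∈ S, ∑ σ, f σ AB := by rw [← mul_sum, sum_comm]
    _ ≤ Real.exp (-L) * ∑ AB ∈ S, 2 ^ Fintype.card ι * Real.exp (t ^ 2 * r / 2) :=
        mul_le_mul_of_nonneg_left (sum_le_sum h2) (Real.exp_nonneg _)
    _ = Real.exp (-L) * #S * (2 ^ Fintype.card ι * Real.exp (t ^ 2 * r / 2)) := by
        rw [sum_const, nsmul_eq_mul, mul_assoc]
    _ ≤ Real.exp (-L) * Real.exp L * (2 ^ Fintype.card ι * Real.exp (t ^ 2 * r / 2)) := by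
        gcongr
    _ = _ := by rw [← Real.exp_add, neg_add_cancel, Real.exp_zero, one_mul]

/-- Successive approximations of the members of a family of bounded VC dimension. -/
theorem exists_chain_of_vcDim_le {ι : Type*} [Fintype ι] [DecidableEq ι] [Nonempty ι]
    {F : Finset (Finset ι)} {d : ℕ} (hF : F.vcDim ≤ d) (hd : 1 ≤ d) :
    ∃ (M : ℕ → Finset (Finset ι)) (p : ℕ → Finset ι → Finset ι) (K : ℕ),
      (∀ k, (#(M k) : ℝ) ≤ Real.exp (3 * d * k)) ∧ (∀ k, ∀ A ∈ F, p k A ∈ M k) ∧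
      (∀ k, ∀ A ∈ F,
        (#(symmDiff (p (k + 1) A) (p k A)) : ℝ) ≤ 5 * (1 / 4) ^ k * Fintype.card ι) ∧
      (∀ A, p 0 A = ∅) ∧ ∀ A ∈ F, p K A = A := by
  set n := Fintype.card ι with hn
  choose N hNcard hNnet using exists_net_of_vcDim_le hF hd
  choose! q hqN hqd using hNnet
  -- The nets are shifted by one so that the chain starts at `∅`, where the process vanishes; hence
  -- the factor `4` in the distances below.
  let M : ℕ → Finset (Finset ι) := fun k => k.casesOn {∅} N
  let p : ℕ → Finset ι → Finset ι := fun k => k.casesOn (fun _ => ∅) q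
  have hMcard : ∀ k, (#(M k) : ℝ) ≤ Real.exp (3 * d * k) := by
    intro k
    cases k with
    | zero => simp [M]
    | succ k => simpa [M] using hNcard k
  have hpM : ∀ k, ∀ A ∈ F, p k A ∈ M k := by
    intro k A hA
    cases k with
    | zero => simp [M, p]
    | succ k => exact hqN k A hA
  have hpd : ∀ k, ∀ A ∈ F, (#(symmDiff A (p k A)) : ℝ) ≤ 4 * (1 / 4) ^ k * n := by
    intro k A hA
    cases k with
    | zero =>
      have h1 : (#(symmDiff A (p 0 A)) : ℝ) ≤ n := by exact_mod_cast card_le_univ _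
      have h2 : (0 : ℝ) ≤ n := n.cast_nonneg
      simp only [pow_zero]
      linarith
    | succ k =>
      have := hqd k A hA
      rw [pow_succ]
      show (#(symmDiff A (q k A)) : ℝ) ≤ _
      linarith
  have hpp : ∀ k, ∀ A ∈ F, (#(symmDiff (p (k + 1) A) (p k A)) : ℝ) ≤ 5 * (1 / 4) ^ k * n := by
    intro k A hA
    have h1 := hpd (k + 1) A hA
    have h2 := hpd k A hA
    have h3 : #(symmDiff (p (k + 1) A) (p k A)) ≤
        #(symmDiff A (p (k + 1) A)) + #(symmDiff A (p k A)) := by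
      refine (card_le_card ?_).trans (card_union_le _ _)
      intro x
      simp only [mem_union, mem_symmDiff]
      tauto
    have h4 : (#(symmDiff (p (k + 1) A) (p k A)) : ℝ) ≤
        #(symmDiff A (p (k + 1) A)) + #(symmDiff A (p k A)) := by exact_mod_cast h3
    rw [pow_succ] at h1
    linarith
  obtain ⟨K, hK⟩ : ∃ K : ℕ, 4 * (1 / 4 : ℝ) ^ K * n < 1 := by
    have hn0 : (0 : ℝ) < n := by exact_mod_cast Fintype.card_pos
    obtain ⟨K, hK⟩ := exists_pow_lt_of_lt_one (show (0 : ℝ) < 1 / (4 * n) by positivity)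
      (show (1 / 4 : ℝ) < 1 by norm_num)
    refine ⟨K, ?_⟩
    rw [lt_div_iff₀ (by positivity)] at hK
    linarith
  have hpK : ∀ A ∈ F, p K A = A := by
    intro A hA
    have h1 := (hpd K A hA).trans_lt hK
    have h2 : #(symmDiff A (p K A)) = 0 := by
      have : #(symmDiff A (p K A)) < 1 := by exact_mod_cast h1
      omega
    rw [card_eq_zero, ← bot_eq_empty, symmDiff_eq_bot] at h2
    exact h2.symm
  exact ⟨M, p, K, hMcard, hpM, hpp, fun _ => rfl, hpK⟩

/-- **Chaining**: the exponential moment of the supremum of the Rademacher process over a family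
of VC dimension at most `d`.  The supremum is expressed by an arbitrary selection `c`. -/
theorem sum_exp_signSum_selection_le {ι : Type*} [Fintype ι] [DecidableEq ι] [Nonempty ι]
    {F : Finset (Finset ι)} {d : ℕ} (hF : F.vcDim ≤ d) (hd : 1 ≤ d) (l : ℝ)
    (c : (ι → Bool) → Finset ι) (hc : ∀ σ, c σ ∈ F) :
    ∑ σ : ι → Bool, Real.exp (l * signSum σ (c σ)) ≤
      2 ^ Fintype.card ι * Real.exp (12 * d + 10 * l ^ 2 * Fintype.card ι) := by
  set n := Fintype.card ι with hn
  obtain ⟨M, p, K, hMcard, hpM, hpp, hp0, hpK⟩ := exists_chain_of_vcDim_le hF hd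
  let Z : ℕ → (ι → Bool) → ℝ := fun k σ => signSum σ (p (k + 1) (c σ)) - signSum σ (p k (c σ))
  have htel : ∀ σ, signSum σ (c σ) = ∑ k ∈ range K, Z k σ := by
    intro σ
    rw [sum_range_sub fun k => signSum σ (p k (c σ)), hpK _ (hc σ)]
    simp [hp0, signSum]
  -- The factor `2 ^ (k + 1)` cancels the Jensen weight, and its square balances the variance scale
  -- `4⁻ᵏ`, so all levels obey the same bound. The subtracted term covers the number of pairs of net
  -- points; its weighted total is at most `12 * d`.
  let u : (ι → Bool) → ℕ → ℝ := fun σ k => l * 2 ^ (k + 1) * Z k σ - 6 * d * (k + 1)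
  have hpoint : ∀ σ, Real.exp (l * signSum σ (c σ)) ≤ Real.exp (12 * d) *
      ((1 / 2) ^ K + ∑ k ∈ range K, (1 / 2) ^ (k + 1) * Real.exp (u σ k)) := by
    intro σ
    refine le_trans ?_ (mul_le_mul_of_nonneg_left (exp_dyadic_sum_le K (u σ)) (Real.exp_nonneg _))
    rw [← Real.exp_add, Real.exp_le_exp]
    have h1 : ∑ k ∈ range K, (1 / 2 : ℝ) ^ (k + 1) * u σ k = l * signSum σ (c σ) -
        6 * d * ∑ k ∈ range K, (1 / 2 : ℝ) ^ (k + 1) * (k + 1) := by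
      rw [htel, mul_sum, mul_sum, ← sum_sub_distrib]
      refine sum_congr rfl fun k _ => ?_
      have : (1 / 2 : ℝ) ^ (k + 1) * 2 ^ (k + 1) = 1 := by
        rw [← mul_pow]; norm_num
      simp only [u]
      linear_combination (l * Z k σ) * this
    have h2 := sum_dyadic_mul_succ_le K
    have h3 : (0 : ℝ) ≤ d := d.cast_nonneg
    rw [h1]
    nlinarith
  have hlevel : ∀ k, ∑ σ, Real.exp (u σ k) ≤ 2 ^ n * Real.exp (10 * l ^ 2 * n) := by
    intro k
    have hcard : (#(M (k + 1)) : ℝ) * #(M k) ≤ Real.exp (6 * d * (k + 1)) := by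
      refine (mul_le_mul (hMcard _) (hMcard _) (by positivity) (by positivity)).trans ?_
      rw [← Real.exp_add, Real.exp_le_exp]
      push_cast
      have : (0 : ℝ) ≤ d := d.cast_nonneg
      linarith
    refine (sum_exp_increment_le (a := fun σ => p (k + 1) (c σ)) (b := fun σ => p k (c σ))
      (t := l * 2 ^ (k + 1)) hcard (fun σ => hpM _ _ (hc σ)) (fun σ => hpM _ _ (hc σ))
      (fun σ => hpp _ _ (hc σ))).trans_eq ?_
    have h5 : ((2 : ℝ) ^ (k + 1)) ^ 2 * (1 / 4) ^ k = 4 := by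
      rw [← pow_mul, mul_comm (k + 1), pow_mul, pow_succ, mul_right_comm, ← mul_pow]
      norm_num
    congr 2
    linear_combination (5 / 2 * l ^ 2 * n) * h5
  have hcardσ : ∑ _σ : ι → Bool, (1 / 2 : ℝ) ^ K = 2 ^ n * (1 / 2) ^ K := by
    simp [hn]
  calc ∑ σ, Real.exp (l * signSum σ (c σ))
      ≤ ∑ σ, Real.exp (12 * d) *
        ((1 / 2) ^ K + ∑ k ∈ range K, (1 / 2) ^ (k + 1) * Real.exp (u σ k)) :=
        sum_le_sum fun σ _ => hpoint σ
    _ = Real.exp (12 * d) * (2 ^ n * (1 / 2) ^ K +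
          ∑ k ∈ range K, (1 / 2) ^ (k + 1) * ∑ σ, Real.exp (u σ k)) := by
        rw [← mul_sum, sum_add_distrib, hcardσ, sum_comm]
        simp only [mul_sum]
    _ ≤ Real.exp (12 * d) * (2 ^ n * Real.exp (10 * l ^ 2 * n) * (1 / 2) ^ K +
          ∑ k ∈ range K, (1 / 2) ^ (k + 1) * (2 ^ n * Real.exp (10 * l ^ 2 * n))) := by
        gcongr with k _
        · exact le_mul_of_one_le_right (by positivity) (Real.one_le_exp (by positivity))
        · exact hlevel k
    _ = 2 ^ n * Real.exp (12 * d + 10 * l ^ 2 * n) := by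
        rw [← sum_mul, sum_dyadic_eq, Real.exp_add]
        ring

end Chaining

/-! ### Ghost samples and uniform deviation -/

section Symmetrization

open Finset

/-- The positions of the sample `s` that fall into `B`. -/
def hits {ι α : Type*} [Fintype ι] [DecidableEq α] (s : ι → α) (B : Finset α) : Finset ι :=
  univ.filter fun i => s i ∈ B

/-- Exchange `s` and `t` at the positions where `σ` is false. -/
def swapBy {ι α : Type*} (σ : ι → Bool) (q : (ι → α) × (ι → α)) : (ι → α) × (ι → α) :=
  (fun i => if σ i then q.1 i else q.2 i, fun i => if σ i then q.2 i else q.1 i)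

theorem swapBy_involutive {ι α : Type*} (σ : ι → Bool) :
    Function.Involutive (swapBy (α := α) σ) := by
  rintro ⟨s, t⟩
  ext i <;> by_cases h : σ i <;> simp [swapBy, h]

theorem prod_swapBy {ι α : Type*} [Fintype ι] (p : α → ℝ) (σ : ι → Bool)
    (q : (ι → α) × (ι → α)) :
    (∏ i, p ((swapBy σ q).1 i)) * ∏ i, p ((swapBy σ q).2 i) =
      (∏ i, p (q.1 i)) * ∏ i, p (q.2 i) := by
  rw [← prod_mul_distrib, ← prod_mul_distrib]
  refine prod_congr rfl fun i _ => ?_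
  by_cases h : σ i <;> simp [swapBy, h, mul_comm]

theorem card_hits_swapBy {ι α : Type*} [Fintype ι] [DecidableEq α] (σ : ι → Bool)
    (q : (ι → α) × (ι → α)) (B : Finset α) :
    (#(hits (swapBy σ q).2 B) : ℝ) - #(hits (swapBy σ q).1 B) =
      signSum σ (hits q.2 B) - signSum σ (hits q.1 B) := by
  simp only [hits, signSum, card_filter, sum_filter, Nat.cast_sum, ← sum_sub_distrib]
  refine sum_congr rfl fun i _ => ?_
  by_cases h : σ i <;> by_cases h1 : q.1 i ∈ B <;> by_cases h2 : q.2 i ∈ B <;>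
    simp [swapBy, boolSign, h, h1, h2]

theorem sum_prod_eq_one {ι α : Type*} [Fintype ι] [DecidableEq ι] [Fintype α] {p : α → ℝ}
    (hp1 : ∑ x, p x = 1) : ∑ s : ι → α, ∏ i, p (s i) = 1 := by
  have h := (prod_univ_sum (fun _ : ι => (univ : Finset α)) fun _ x => p x).symm
  rw [Fintype.piFinset_univ] at h
  simp [h, hp1]

/-- Jensen's inequality for the exponential moment of the number of hits of a random sample. -/
theorem exp_le_sum_prod_mul_exp_hits {ι α : Type*} [Fintype ι] [DecidableEq ι] [Fintype α]
    [DecidableEq α] {p : α → ℝ} (hp : ∀ x, 0 ≤ p x) (hp1 : ∑ x, p x = 1) (l : ℝ)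
    (B : Finset α) :
    Real.exp (l * (Fintype.card ι * ∑ x ∈ B, p x)) ≤
      ∑ s : ι → α, (∏ i, p (s i)) * Real.exp (l * #(hits s B)) := by
  have h1 : ∑ s : ι → α, (∏ i, p (s i)) * Real.exp (l * #(hits s B)) =
      (∑ x, p x * Real.exp (if x ∈ B then l else 0)) ^ Fintype.card ι := by
    rw [← card_univ, ← prod_const, prod_univ_sum, Fintype.piFinset_univ]
    refine sum_congr rfl fun s _ => ?_
    rw [prod_mul_distrib, ← Real.exp_sum]
    congr 2
    simp only [hits, card_filter, Nat.cast_sum, mul_sum]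
    exact sum_congr rfl fun i _ => by split_ifs <;> simp
  have h2 := convexOn_exp.map_sum_le (t := univ) (w := p)
    (p := fun x => if x ∈ B then l else 0) (fun x _ => hp x) hp1 (fun _ _ => Set.mem_univ _)
  have h3 : ∑ x, p x • (if x ∈ B then l else 0) = l * ∑ x ∈ B, p x := by
    rw [mul_sum]
    simp only [smul_eq_mul, mul_ite, mul_zero, sum_ite_mem, univ_inter]
    exact sum_congr rfl fun x _ => mul_comm _ _
  rw [h3] at h2
  rw [h1, ← mul_assoc, mul_comm l, mul_assoc, Real.exp_nat_mul]
  exact pow_le_pow_left₀ (Real.exp_nonneg _) h2 _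

/-- Exponential moment bound for the ghost-sample process along a selection `b`. -/
theorem sum_ghost_exp_le {ι α : Type*} [Fintype ι] [DecidableEq ι] [Nonempty ι] [Fintype α]
    [DecidableEq α] {p : α → ℝ} (hp : ∀ x, 0 ≤ p x) (hp1 : ∑ x, p x = 1)
    {D : Finset (Finset α)} {d : ℕ} (hD : D.vcDim ≤ d) (hd : 1 ≤ d) (l : ℝ)
    {b : (ι → α) → Finset α} (hb : ∀ s, b s ∈ D) :
    ∑ q : (ι → α) × (ι → α), ((∏ i, p (q.1 i)) * ∏ i, p (q.2 i)) *
        Real.exp (l * (#(hits q.2 (b q.1)) - #(hits q.1 (b q.1)))) ≤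
      Real.exp (12 * d + 40 * l ^ 2 * Fintype.card ι) := by
  set n := Fintype.card ι with hn
  set E := Real.exp (12 * d + 40 * l ^ 2 * n) with hE
  let W : (ι → α) × (ι → α) → ℝ := fun q => (∏ i, p (q.1 i)) * ∏ i, p (q.2 i)
  have hW : ∀ q, 0 ≤ W q := fun q =>
    mul_nonneg (prod_nonneg fun i _ => hp _) (prod_nonneg fun i _ => hp _)
  have hWsum : ∑ q, W q = 1 := by
    rw [Fintype.sum_prod_type]
    simp only [W, ← mul_sum, sum_prod_eq_one hp1, mul_one]
  set g : (ι → α) × (ι → α) → ℝ := fun q => W q *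
    Real.exp (l * (#(hits q.2 (b q.1)) - #(hits q.1 (b q.1)))) with hg
  -- The swap preserves the product weight. The selected set now depends on `σ` through the swapped
  -- sample, which is why chaining was stated for arbitrary selections.
  have hswap : ∀ σ : ι → Bool, ∑ q, g q = ∑ q, W q * Real.exp (l *
      (signSum σ (hits q.2 (b (swapBy σ q).1)) - signSum σ (hits q.1 (b (swapBy σ q).1)))) := by
    intro σ
    rw [← Equiv.sum_comp (swapBy_involutive σ).toPerm g]
    refine sum_congr rfl fun q _ => ?_
    simp only [hg, W, Function.Involutive.coe_toPerm, prod_swapBy, card_hits_swapBy]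
  have hchain : ∀ (t : ℝ) (s : ι → α) (c : (ι → Bool) → Finset α), (∀ σ, c σ ∈ D) →
      ∑ σ, Real.exp (t * signSum σ (hits s (c σ))) ≤
        2 ^ n * Real.exp (12 * d + 10 * t ^ 2 * n) := fun t s c hc =>
    sum_exp_signSum_selection_le ((vcDim_image_preimage_le D s).trans hD) hd t
      (fun σ => hits s (c σ)) fun σ => mem_image_of_mem _ (hc σ)
  have hq : ∀ q : (ι → α) × (ι → α), ∑ σ : ι → Bool, Real.exp (l *
      (signSum σ (hits q.2 (b (swapBy σ q).1)) - signSum σ (hits q.1 (b (swapBy σ q).1)))) ≤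
        2 ^ n * E := by
    intro q
    have h1 := hchain (2 * l) q.2 (fun σ => b (swapBy σ q).1) fun σ => hb _
    have h2 := hchain (-2 * l) q.1 (fun σ => b (swapBy σ q).1) fun σ => hb _
    rw [show 12 * (d : ℝ) + 10 * (2 * l) ^ 2 * n = 12 * d + 40 * l ^ 2 * n by ring, ← hE] at h1
    rw [show 12 * (d : ℝ) + 10 * (-2 * l) ^ 2 * n = 12 * d + 40 * l ^ 2 * n by ring, ← hE] at h2
    -- Convexity separates the two samples at the price of doubling `l`, which turns `10 * l ^ 2`
    -- into `40 * l ^ 2`.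
    have h3 : ∀ x y : ℝ, Real.exp (l * (x - y)) ≤
        1 / 2 * Real.exp (2 * l * x) + 1 / 2 * Real.exp (-2 * l * y) := by
      intro x y
      have h4 := convexOn_exp.2 (Set.mem_univ (2 * l * x)) (Set.mem_univ (-2 * l * y))
        (by norm_num : (0 : ℝ) ≤ 1 / 2) (by norm_num : (0 : ℝ) ≤ 1 / 2) (by norm_num)
      simp only [smul_eq_mul] at h4
      rwa [show 1 / 2 * (2 * l * x) + 1 / 2 * (-2 * l * y) = l * (x - y) by ring] at h4
    refine (sum_le_sum fun σ _ => h3 _ _).trans ?_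
    rw [sum_add_distrib, ← mul_sum, ← mul_sum]
    linarith
  have htotal : (2 : ℝ) ^ n * ∑ q, g q ≤ 2 ^ n * E := by
    calc (2 : ℝ) ^ n * ∑ q, g q = ∑ _σ : ι → Bool, ∑ q, g q := by simp [hn]
      _ = ∑ q, W q * ∑ σ : ι → Bool, Real.exp (l * (signSum σ (hits q.2 (b (swapBy σ q).1)) -
            signSum σ (hits q.1 (b (swapBy σ q).1)))) := by
          rw [sum_congr rfl fun σ _ => hswap σ, sum_comm]
          simp only [mul_sum]
      _ ≤ ∑ q, W q * (2 ^ n * E) :=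
          sum_le_sum fun q _ => mul_le_mul_of_nonneg_left (hq q) (hW q)
      _ = 2 ^ n * E := by rw [← sum_mul, hWsum, one_mul]
  exact le_of_mul_le_mul_left htotal (by positivity)

/-- **Uniform convergence** without a logarithmic loss for families of bounded VC dimension. -/
theorem sum_prod_deviation_le {ι α : Type*} [Fintype ι] [DecidableEq ι] [Nonempty ι]
    [Fintype α] [DecidableEq α] {p : α → ℝ} (hp : ∀ x, 0 ≤ p x) (hp1 : ∑ x, p x = 1)
    {D : Finset (Finset α)} {d : ℕ} (hD : D.vcDim ≤ d) (hd : 1 ≤ d) {l : ℝ} (hl : 0 ≤ l)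
    (θ : ℝ) {bad : Finset (ι → α)}
    (hbad : ∀ s ∈ bad, ∃ B ∈ D, #(hits s B) + θ ≤ Fintype.card ι * ∑ x ∈ B, p x) :
    ∑ s ∈ bad, ∏ i, p (s i) ≤ Real.exp (12 * d + 40 * l ^ 2 * Fintype.card ι - l * θ) := by
  rcases bad.eq_empty_or_nonempty with rfl | ⟨s₀, hs₀⟩
  · simpa using Real.exp_nonneg _
  obtain ⟨B₀, hB₀, -⟩ := hbad s₀ hs₀
  have hsel : ∀ s : ι → α, ∃ B ∈ D, s ∈ bad →
      #(hits s B) + θ ≤ Fintype.card ι * ∑ x ∈ B, p x := by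
    intro s
    by_cases hs : s ∈ bad
    · obtain ⟨B, hB, h⟩ := hbad s hs
      exact ⟨B, hB, fun _ => h⟩
    · exact ⟨B₀, hB₀, fun h => absurd h hs⟩
  choose b hbD hb using hsel
  have hW : ∀ s : ι → α, 0 ≤ ∏ i, p (s i) := fun s => prod_nonneg fun i _ => hp _
  -- The exponential Markov inequality, with the true mean replaced by the hits of a ghost sample
  -- `t` through Jensen.
  have h1 : ∀ s ∈ bad, Real.exp (l * θ) * ∏ i, p (s i) ≤
      ∑ t : ι → α, ((∏ i, p (s i)) * ∏ i, p (t i)) *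
        Real.exp (l * (#(hits t (b s)) - #(hits s (b s)))) := by
    intro s hs
    have h2 : Real.exp (l * θ) ≤ Real.exp (-(l * #(hits s (b s)))) *
        Real.exp (l * (Fintype.card ι * ∑ x ∈ b s, p x)) := by
      rw [← Real.exp_add, Real.exp_le_exp]
      have := mul_le_mul_of_nonneg_left (hb s hs) hl
      linarith
    have h3 := h2.trans (mul_le_mul_of_nonneg_left
      (exp_le_sum_prod_mul_exp_hits (ι := ι) hp hp1 l (b s)) (Real.exp_nonneg _))
    refine (mul_le_mul_of_nonneg_right h3 (hW s)).trans_eq ?_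
    rw [mul_sum, sum_mul]
    refine sum_congr rfl fun t _ => ?_
    rw [mul_sub, sub_eq_add_neg, Real.exp_add]
    ring
  have h4 : Real.exp (l * θ) * ∑ s ∈ bad, ∏ i, p (s i) ≤
      Real.exp (12 * d + 40 * l ^ 2 * Fintype.card ι) := by
    refine le_trans ?_ (sum_ghost_exp_le hp hp1 hD hd l hbD)
    rw [mul_sum, Fintype.sum_prod_type]
    refine (sum_le_sum h1).trans (sum_le_sum_of_subset_of_nonneg (subset_univ _) ?_)
    intro s _ _
    exact sum_nonneg fun t _ => mul_nonneg (mul_nonneg (hW s) (hW t)) (Real.exp_nonneg _)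
  rw [Real.exp_sub, le_div_iff₀ (Real.exp_pos _), mul_comm]
  exact h4

end Symmetrization

/-! ### VC dimension of contrastive classifiers -/

section ContrastiveClass

open Finset

/-- The set of points at which two classifiers disagree. -/
def disagreement {α : Type*} [Fintype α] (h k : α → Bool) : Finset α :=
  univ.filter fun x => h x ≠ k x

/-- The disagreement sets of a class with a fixed target. -/
noncomputable def disagreements {α : Type*} [Fintype α] [DecidableEq α] (H : Set (α → Bool))
    (k : α → Bool) : Finset (Finset α) :=
  H.toFinite.toFinset.image fun h => disagreement h k

theorem mem_disagreements {α : Type*} [Fintype α] [DecidableEq α] {H : Set (α → Bool)}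
    {h k : α → Bool} (hh : h ∈ H) : disagreement h k ∈ disagreements H k :=
  mem_image_of_mem _ (by simpa using hh)

/-- Exclusive or with the fixed `k` permutes the labelings of `s`, so passing to disagreement sets
loses nothing. -/
theorem exists_mem_eq_of_shatters_disagreements {α : Type*} [Fintype α] [DecidableEq α]
    {H : Set (α → Bool)} {k : α → Bool} {s : Finset α} (hs : (disagreements H k).Shatters s)
    (f : α → Bool) : ∃ h ∈ H, ∀ x ∈ s, h x = f x := by
  obtain ⟨u, hu, hsu⟩ := hs (filter_subset (fun x => f x ≠ k x) s)
  obtain ⟨h, hh, rfl⟩ := mem_image.1 hu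
  refine ⟨h, by simpa using hh, fun x hx => ?_⟩
  have h1 := Finset.ext_iff.1 hsu x
  simp only [disagreement, mem_inter, mem_filter, mem_univ, true_and, hx] at h1
  revert h1
  cases h x <;> cases f x <;> cases k x <;> simp

/-- The contrastive classifiers are half-spaces in `ℝ^(V × V)`, so that the VC dimension of the
class is at most `|V| ^ 2`. -/
theorem vcDim_disagreements_contrastiveClass_le {V : Type*} [Fintype V] [DecidableEq V]
    (R : Set (V → V → ℝ)) (k : V × V × V → Bool) :
    (disagreements (contrastiveClass R) k).vcDim ≤ Fintype.card V ^ 2 := by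
  refine Finset.sup_le fun s hs => ?_
  rw [mem_shatterer] at hs
  by_contra! hcard
  let v : s → (V × V → ℝ) := fun t =>
    Pi.single (t.1.1, t.1.2.1) 1 - Pi.single (t.1.1, t.1.2.2) 1
  have hdep : ¬ LinearIndependent ℝ v := by
    intro h
    have := h.fintype_card_le_finrank
    simp only [Fintype.card_coe, Module.finrank_fintype_fun_eq_card, Fintype.card_prod] at this
    rw [sq] at hcard
    omega
  -- A negative coefficient is needed because only the label `false` gives a strict inequality; ties
  -- are labelled `true`.
  obtain ⟨a, ha, hneg⟩ : ∃ a : s → ℝ, ∑ i, a i • v i = 0 ∧ ∃ i, a i < 0 := by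
    obtain ⟨a, ha, i, hi⟩ := Fintype.not_linearIndependent_iff.1 hdep
    rcases lt_or_gt_of_ne hi with h | h
    · exact ⟨a, ha, i, h⟩
    · exact ⟨-a, by simp only [Pi.neg_apply, neg_smul, sum_neg_distrib, ha, neg_zero], i, by simpa using h⟩
  -- Realizing the sign pattern of `a` makes every term of the vanishing combination nonnegative and
  -- one of them positive.
  obtain ⟨h, ⟨ρ, -, rfl⟩, hρ⟩ := exists_mem_eq_of_shatters_disagreements hs
    fun x => if hx : x ∈ s then decide (0 ≤ a ⟨x, hx⟩) else true
  have hval : ∀ i : s, (0 ≤ ρ i.1.1 i.1.2.1 - ρ i.1.1 i.1.2.2 ↔ 0 ≤ a i) := by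
    intro i
    have := hρ i.1 i.2
    simp only [contrastiveHyp, i.2, dite_true, decide_eq_decide] at this
    rwa [sub_nonneg]
  have hsum : ∑ i, a i * (ρ i.1.1 i.1.2.1 - ρ i.1.1 i.1.2.2) = 0 := by
    have h1 : ∑ q : V × V, (∑ i, a i • v i) q * ρ q.1 q.2 = 0 := by
      simp only [ha, Pi.zero_apply, zero_mul, sum_const_zero]
    rw [← h1]
    simp only [Finset.sum_apply, Pi.smul_apply, smul_eq_mul, sum_mul]
    rw [sum_comm]
    refine sum_congr rfl fun i _ => ?_
    simp only [v, Pi.sub_apply, mul_assoc, ← mul_sum, sub_mul, sum_sub_distrib, Pi.single_apply,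
      ite_mul, one_mul, zero_mul, sum_ite_eq', mem_univ, if_true]
  have hpos : 0 < ∑ i, a i * (ρ i.1.1 i.1.2.1 - ρ i.1.1 i.1.2.2) := by
    obtain ⟨j, hj⟩ := hneg
    refine sum_pos' (fun i _ => ?_) ⟨j, mem_univ _, ?_⟩
    · by_cases hi : 0 ≤ a i
      · exact mul_nonneg hi ((hval i).2 hi)
      · exact mul_nonneg_of_nonpos_of_nonpos (not_le.1 hi).le
          (not_le.1 fun h => hi ((hval i).1 h)).le
    · exact mul_pos_of_neg_of_neg hj (not_le.1 fun h => not_le.2 hj ((hval j).1 h))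
  exact hpos.ne' hsum

end ContrastiveClass

/-! ### Binomial tail bound -/

section BinomialTail

open MeasureTheory ProbabilityTheory

/-- A Chernoff bound for the binomial distribution. -/
theorem binomial_real_ge_le (n : ℕ) (p : unitInterval) {u : ℝ} (hu : 0 ≤ u) (hu1 : u ≤ 2) :
    (binomial n p).real {k : ℕ | n * ((p : ℝ) + u) ≤ k} ≤ Real.exp (-(n * u ^ 2 / 4)) := by
  have hp0 : (0 : ℝ) ≤ p := p.2.1
  have hp1 : (p : ℝ) ≤ 1 := p.2.2
  -- This minimizes the exponent `-t * u + t ^ 2`; `u ≤ 2` ensures `t ≤ 1`, where `exp t ≤ 1 + t + t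
  -- ^ 2`.
  set t := u / 2 with ht
  have h := measure_ge_le_exp_mul_mgf (μ := binomial n p) (X := fun k : ℕ => (k : ℝ))
    (n * ((p : ℝ) + u)) (t := t) (by positivity) (integrable_binomial _)
  have hmgf : mgf (fun k : ℕ => (k : ℝ)) (binomial n p) t =
      (p * Real.exp t + (1 - p)) ^ n := by
    rw [mgf, integral_binomial, add_pow, ← Nat.range_succ_eq_Iic]
    refine Finset.sum_congr rfl fun k _ => ?_
    rw [smul_eq_mul, mul_pow, ← Real.exp_nat_mul, mul_comm t]
    ring
  have hbase : p * Real.exp t + (1 - p) ≤ Real.exp (p * t + t ^ 2) := by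
    have h1 := (abs_le.1 (Real.abs_exp_sub_one_sub_id_le
      (abs_le.2 ⟨by linarith, by linarith⟩ : |t| ≤ 1))).2
    have h2 := Real.add_one_le_exp (p * t + t ^ 2)
    nlinarith [mul_le_mul_of_nonneg_left h1 hp0, mul_nonneg (sub_nonneg.2 hp1) (sq_nonneg t)]
  have hbase0 : 0 ≤ p * Real.exp t + (1 - p) :=
    add_nonneg (mul_nonneg hp0 (Real.exp_nonneg _)) (sub_nonneg.2 hp1)
  have hpow := pow_le_pow_left₀ hbase0 hbase n
  refine h.trans ?_
  rw [hmgf]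
  refine (mul_le_mul_of_nonneg_left hpow (Real.exp_nonneg _)).trans_eq ?_
  rw [← Real.exp_nat_mul, ← Real.exp_add]
  congr 1
  rw [ht]
  ring

end BinomialTail

/-! ### Learning by empirical risk minimization -/

section Learning

open Finset

/-- The number of examples in the labelled sample `S` that `h` gets wrong. -/
def mistakes {α : Type*} {n : ℕ} (h : α → Bool) (S : Fin n → α × Bool) : ℕ :=
  #{i | h (S i).1 ≠ (S i).2}

theorem exists_empirical_risk_minimizer {α : Type*} [Finite α] {H : Set (α → Bool)}
    (hH : H.Nonempty) (n : ℕ) :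
    ∃ A : (Fin n → α × Bool) → (α → Bool),
      ∀ S, A S ∈ H ∧ ∀ h ∈ H, mistakes (A S) S ≤ mistakes h S := by
  choose A hA using fun S : Fin n → α × Bool =>
    Set.exists_min_image H (fun h => mistakes h S) H.toFinite hH
  exact ⟨A, hA⟩

/-- If a corrupted sample `S` agrees with the correctly labelled `s` off `T`, then an empirical
risk minimizer on `S` makes at most `2 |T|` mistakes on `s`. -/
theorem card_hits_disagreement_le {α : Type*} [Fintype α] [DecidableEq α] {n : ℕ}
    {h hstar : α → Bool} {s : Fin n → α} {T : Finset (Fin n)} {S : Fin n → α × Bool}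
    (hS : ∀ i, i ∉ T → S i = (s i, hstar (s i))) (hmin : mistakes h S ≤ mistakes hstar S) :
    #(hits s (disagreement h hstar)) ≤ 2 * #T := by
  have h1 : mistakes hstar S ≤ #T := by
    refine card_le_card fun i hi => ?_
    by_contra hT
    simp [hS i hT] at hi
  have h2 : #(hits s (disagreement h hstar)) ≤ #T + mistakes h S := by
    refine (card_le_card ?_).trans (card_union_le _ _)
    intro i hi
    by_cases hT : i ∈ T
    · exact mem_union_left _ hT
    · refine mem_union_right _ ?_
      simp only [hits, disagreement, mem_filter, mem_univ, true_and] at hi ⊢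
      simpa [hS i hT] using hi
  omega

theorem classificationError_eq {α : Type*} [Fintype α] (D : PMF α) (h hstar : α → Bool) :
    classificationError D h hstar =
      ENNReal.ofReal (∑ x ∈ disagreement h hstar, (D x).toReal) := by
  have h1 : {x | h x ≠ hstar x} = (disagreement h hstar : Set α) := by
    ext x; simp [disagreement]
  rw [classificationError, h1, PMF.toOuterMeasure_apply_finset,
    ENNReal.ofReal_sum_of_nonneg fun _ _ => ENNReal.toReal_nonneg]
  exact sum_congr rfl fun x _ => (ENNReal.ofReal_toReal (D.apply_ne_top x)).symm

theorem sum_toReal_eq_one {α : Type*} [Fintype α] (D : PMF α) : ∑ x, (D x).toReal = 1 := by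
  rw [← ENNReal.toReal_sum fun x _ => D.apply_ne_top x, ← tsum_fintype (L := .unconditional α),
    D.tsum_coe, ENNReal.toReal_one]

/-- The probability that the clean sample of a nasty adversary lies in `bad`. -/
theorem IsNastyAdversary.outerMeasure_sample_mem {α : Type*} {D : PMF α}
    {hstar : α → Bool} {η : unitInterval} {n : ℕ}
    {law : PMF ((Fin n → α) × Finset (Fin n) × (Fin n → α × Bool))}
    (hlaw : IsNastyAdversary D hstar η n law) (bad : Finset (Fin n → α)) :
    law.toOuterMeasure {ω | ω.1 ∈ bad} =
      ENNReal.ofReal (∑ s ∈ bad, ∏ i, (D (s i)).toReal) := by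
  have h1 : {ω : (Fin n → α) × Finset (Fin n) × (Fin n → α × Bool) | ω.1 ∈ bad} =
      (fun ω => ω.1) ⁻¹' (bad : Set (Fin n → α)) := by ext; simp
  rw [h1, ← PMF.toOuterMeasure_map_apply, PMF.toOuterMeasure_apply_finset,
    ENNReal.ofReal_sum_of_nonneg fun _ _ => prod_nonneg fun _ _ => ENNReal.toReal_nonneg]
  refine sum_congr rfl fun s _ => ?_
  rw [hlaw.iid_sample, ENNReal.ofReal_prod_of_nonneg fun _ _ => ENNReal.toReal_nonneg]
  exact prod_congr rfl fun i _ => (ENNReal.ofReal_toReal (D.apply_ne_top _)).symm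

/-- The number of corrupted examples is rarely much larger than its mean. -/
theorem IsNastyAdversary.outerMeasure_card_ge_le {α : Type*} {D : PMF α}
    {hstar : α → Bool} {η : unitInterval} {n : ℕ}
    {law : PMF ((Fin n → α) × Finset (Fin n) × (Fin n → α × Bool))}
    (hlaw : IsNastyAdversary D hstar η n law) {u : ℝ} (hu : 0 ≤ u) (hu1 : u ≤ 2) :
    law.toOuterMeasure {ω | n * ((η : ℝ) + u) ≤ #ω.2.1} ≤
      ENNReal.ofReal (Real.exp (-(n * u ^ 2 / 4))) := by
  have h1 : {ω : (Fin n → α) × Finset (Fin n) × (Fin n → α × Bool) |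
      n * ((η : ℝ) + u) ≤ #ω.2.1} =
      (fun ω => ω.2.1.card) ⁻¹' {k : ℕ | n * ((η : ℝ) + u) ≤ k} := rfl
  rw [h1, ← PMF.toOuterMeasure_map_apply, ← PMF.toMeasure_apply_eq_toOuterMeasure,
    hlaw.card_binomial]
  refine ENNReal.le_ofReal_iff_toReal_le (MeasureTheory.measure_ne_top _ _)
    (Real.exp_nonneg _) |>.2 ?_
  exact binomial_real_ge_le n η hu hu1

/-- An event that contains the complement of two unlikely events is likely. -/
theorem ofReal_one_sub_le_of_unlikely {Ω : Type*} (law : PMF Ω) {good bad₁ bad₂ : Set Ω} {δ : ℝ}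
    (hδ : 0 ≤ δ) (hcover : ∀ ω ∈ law.support, ω ∉ bad₁ → ω ∉ bad₂ → ω ∈ good)
    (h₁ : law.toOuterMeasure bad₁ ≤ ENNReal.ofReal (δ / 2))
    (h₂ : law.toOuterMeasure bad₂ ≤ ENNReal.ofReal (δ / 2)) :
    ENNReal.ofReal (1 - δ) ≤ law.toOuterMeasure good := by
  rw [ENNReal.ofReal_sub _ hδ, ENNReal.ofReal_one, tsub_le_iff_right]
  have h3 : law.toOuterMeasure Set.univ = 1 :=
    (law.toOuterMeasure_apply_eq_one_iff _).2 (Set.subset_univ _)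
  have h4 : law.toOuterMeasure Set.univ ≤ law.toOuterMeasure (good ∪ (bad₁ ∪ bad₂)) := by
    refine law.toOuterMeasure_mono fun ω hω => ?_
    by_cases hb1 : ω ∈ bad₁
    · exact Or.inr (Or.inl hb1)
    by_cases hb2 : ω ∈ bad₂
    · exact Or.inr (Or.inr hb2)
    exact Or.inl (hcover ω hω.2 hb1 hb2)
  rw [h3] at h4
  refine h4.trans ((MeasureTheory.measure_union_le _ _).trans ?_)
  gcongr
  refine (MeasureTheory.measure_union_le _ _).trans ((add_le_add h₁ h₂).trans_eq ?_)
  rw [← ENNReal.ofReal_add (by linarith) (by linarith), add_halves]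

/-- Classes with disagreement sets of VC dimension at most `d` are learnable under nasty noise
from `O((d + log (1 / δ)) / Δ ^ 2)` examples. -/
theorem exists_nastyPACLearns_of_vcDim_le {α : Type*} [Fintype α] [DecidableEq α]
    {H : Set (α → Bool)} (hH : H.Nonempty) {d : ℕ} (hd : 1 ≤ d)
    (hvc : ∀ k, (disagreements H k).vcDim ≤ d) (η : unitInterval) {Δ δ : ℝ} (hΔ : 0 < Δ)
    (hΔ1 : Δ ≤ 1) (hδ : 0 < δ) (hδ1 : δ < 1) {n : ℕ}
    (hn : 8320 / Δ ^ 2 * (d + Real.log (1 / δ)) ≤ n) :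
    ∃ A, NastyPACLearns H η (2 * (η : ℝ) + Δ) δ n A := by
  obtain ⟨A, hA⟩ := exists_empirical_risk_minimizer hH n
  refine ⟨A, fun S => (hA S).1, fun hstar hstarH D law hlaw => ?_⟩
  set L := Real.log (1 / δ) with hL
  have hL0 : 0 < L := Real.log_pos (by rw [lt_div_iff₀ hδ]; linarith)
  have hd1 : (1 : ℝ) ≤ d := by exact_mod_cast hd
  have hη : (0 : ℝ) ≤ η := η.2.1
  have hnΔ : 8320 * (d + L) ≤ n * Δ ^ 2 := by
    rwa [div_mul_eq_mul_div, div_le_iff₀ (by positivity)] at hn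
  have hn0 : 0 < n := by
    rcases Nat.eq_zero_or_pos n with rfl | h
    · simp only [Nat.cast_zero, zero_mul] at hnΔ
      linarith
    · exact h
  have hn0' : (0 : ℝ) < n := by exact_mod_cast hn0
  have : Nonempty (Fin n) := ⟨⟨0, hn0⟩⟩
  have hhalf : Real.exp (-(Real.log 2 + L)) = δ / 2 := by
    rw [hL, one_div, Real.log_inv, neg_add, neg_neg, Real.exp_add, Real.exp_neg,
      Real.exp_log two_pos, Real.exp_log hδ]
    ring
  have hlog2 := Real.log_two_lt_d9
  classical
  let bad : Finset (Fin n → α) := univ.filter fun s => ∃ B ∈ disagreements H hstar,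
    #(hits s B) + n * (Δ / 2) ≤ n * ∑ x ∈ B, (D x).toReal
  -- The accuracy splits as `2η + Δ = 2(η + Δ/4) + Δ/2`: corruption, then sampling error.
  refine ofReal_one_sub_le_of_unlikely law (bad₁ := {ω | ω.1 ∈ bad})
    (bad₂ := {ω | n * ((η : ℝ) + Δ / 4) ≤ #ω.2.1}) hδ.le ?_ ?_ ?_
  · intro ω hω h1 h2
    have h3 := card_hits_disagreement_le (hlaw.unchanged ω hω) ((hA ω.2.2).2 hstar hstarH)
    have h4 : (#(hits ω.1 (disagreement (A ω.2.2) hstar)) : ℝ) ≤ 2 * #ω.2.1 := by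
      exact_mod_cast h3
    have h5 : (#ω.2.1 : ℝ) < n * ((η : ℝ) + Δ / 4) := not_le.1 h2
    have h6 : n * ∑ x ∈ disagreement (A ω.2.2) hstar, (D x).toReal <
        #(hits ω.1 (disagreement (A ω.2.2) hstar)) + n * (Δ / 2) := by
      by_contra! hcon
      exact h1 (mem_filter.2 ⟨mem_univ _, _, mem_disagreements (hA ω.2.2).1, hcon⟩)
    show classificationError D (A ω.2.2) hstar < _
    rw [classificationError_eq, ENNReal.ofReal_lt_ofReal_iff (by positivity)]
    refine lt_of_mul_lt_mul_left ?_ hn0'.le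
    linarith
  · rw [hlaw.outerMeasure_sample_mem]
    refine ENNReal.ofReal_le_ofReal ?_
    -- `l = Δ / 160` minimizes `40 * l ^ 2 - l * Δ / 2`, with value `-Δ ^ 2 / 640`. The constant
    -- `8320 = 640 * 13` then covers `12 * d + log 2 + L`.
    have h1 := sum_prod_deviation_le (ι := Fin n) (p := fun x => (D x).toReal)
      (fun x => ENNReal.toReal_nonneg) (sum_toReal_eq_one D) (hvc hstar) hd (l := Δ / 160)
      (by positivity) (n * (Δ / 2)) (bad := bad)
      fun s hs => by simpa using (mem_filter.1 hs).2
    refine h1.trans ?_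
    rw [← hhalf, Real.exp_le_exp, Fintype.card_fin]
    linarith
  · refine (hlaw.outerMeasure_card_ge_le (by positivity) (by linarith)).trans ?_
    refine ENNReal.ofReal_le_ofReal ?_
    rw [← hhalf, Real.exp_le_exp]
    linarith

/-- If the accuracy exceeds `1`, or if there are no points, every rule learns. -/
theorem exists_nastyPACLearns_of_trivial {α : Type*} {H : Set (α → Bool)} (hH : H.Nonempty)
    (η : unitInterval) {ε δ : ℝ} (hδ : 0 < δ) (h : IsEmpty α ∨ 1 < ε) (n : ℕ) :
    ∃ A, NastyPACLearns H η ε δ n A := by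
  obtain ⟨k, hk⟩ := hH
  refine ⟨fun _ => k, fun _ => hk, fun hstar _ D law _ => ?_⟩
  rcases h with h | h
  · exact (h.false D.support_nonempty.choose).elim
  have h1 : law.toOuterMeasure {ω | classificationError D k hstar < ENNReal.ofReal ε} = 1 := by
    refine (law.toOuterMeasure_apply_eq_one_iff _).2 fun ω _ => ?_
    refine lt_of_le_of_lt ?_ (ENNReal.one_lt_ofReal.2 h)
    rw [← (D.toOuterMeasure_apply_eq_one_iff Set.univ).2 (Set.subset_univ _)]
    exact MeasureTheory.measure_mono (Set.subset_univ _)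
  rw [h1]
  exact ENNReal.ofReal_le_one.2 (by linarith)

theorem exists_nastySampleComplexity_eq {α : Type*} {H : Set (α → Bool)} {η : unitInterval}
    {ε δ B : ℝ} {n : ℕ} (hA : ∃ A, NastyPACLearns H η ε δ n A) (hn : (n : ℝ) ≤ B) :
    ∃ m : ℕ, nastySampleComplexity H η ε δ = (m : ℕ∞) ∧ (m : ℝ) ≤ B := by
  have h1 : nastySampleComplexity H η ε δ ≤ n := iInf₂_le n hA
  obtain ⟨m, hm⟩ := ENat.ne_top_iff_exists.1 (ne_top_of_le_ne_top (ENat.natCast_ne_top n) h1)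
  rw [← hm, Nat.cast_le] at h1
  exact ⟨m, hm.symm, le_trans (by exact_mod_cast h1) hn⟩

end Learning

theorem theorem4p6 :
    ∃ C : ℝ, 0 < C ∧
      ∀ (V : Type*) [Fintype V] (R : Set (V → V → ℝ)), R.Nonempty →
        ∀ (η : unitInterval) (Δ δ : ℝ), 0 < (η : ℝ) → 0 < Δ → 0 < δ → δ < 1 →
          (∃ n : ℕ,
            nastySampleComplexity (contrastiveClass R) η (2 * (η : ℝ) + Δ) δ = (n : ℕ∞) ∧
              (n : ℝ) ≤ C / Δ ^ 2 * ((Fintype.card V : ℝ) ^ 2 + Real.log (1 / δ))) ∧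
          ∀ n : ℕ, C / Δ ^ 2 * ((Fintype.card V : ℝ) ^ 2 + Real.log (1 / δ)) ≤ (n : ℝ) →
            ∃ A, NastyPACLearns (contrastiveClass R) η (2 * (η : ℝ) + Δ) δ n A := by

  classical
  -- Twice `8320`: rounding the bound up to an integer adds less than `1`, and outside the trivial
  -- cases the bound itself is at least `1`.
  refine ⟨16640, by norm_num, ?_⟩
  intro V _ R hR η Δ δ hη hΔ hδ hδ1
  have hH : (contrastiveClass R).Nonempty := hR.image _
  have hL0 : 0 < Real.log (1 / δ) := Real.log_pos (by rw [lt_div_iff₀ hδ]; linarith)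
  by_cases htriv : IsEmpty V ∨ 1 < Δ
  · have hall : ∀ n, ∃ A, NastyPACLearns (contrastiveClass R) η (2 * (η : ℝ) + Δ) δ n A := by
      refine exists_nastyPACLearns_of_trivial hH η hδ ?_
      rcases htriv with h | h
      · exact Or.inl inferInstance
      · exact Or.inr (by linarith)
    refine ⟨exists_nastySampleComplexity_eq (hall 0) ?_, fun n _ => hall n⟩
    rw [Nat.cast_zero]
    positivity
  push Not at htriv
  obtain ⟨hV, hΔ1⟩ := htriv
  have hcard : 1 ≤ Fintype.card V ^ 2 := Nat.one_le_pow _ _ Fintype.card_pos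
  have hcard' : (1 : ℝ) ≤ (Fintype.card V : ℝ) ^ 2 := by exact_mod_cast hcard
  have hlearn : ∀ n : ℕ,
      8320 / Δ ^ 2 * ((Fintype.card V : ℝ) ^ 2 + Real.log (1 / δ)) ≤ (n : ℝ) →
        ∃ A, NastyPACLearns (contrastiveClass R) η (2 * (η : ℝ) + Δ) δ n A := fun n hn =>
    exists_nastyPACLearns_of_vcDim_le hH hcard (vcDim_disagreements_contrastiveClass_le R) η hΔ hΔ1
      hδ hδ1 (by exact_mod_cast hn)
  set Q := (Fintype.card V : ℝ) ^ 2 + Real.log (1 / δ) with hQ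
  have hone : 1 ≤ 8320 / Δ ^ 2 * Q := by
    have h1 : (1 : ℝ) ≤ 8320 / Δ ^ 2 := by
      rw [le_div_iff₀ (by positivity)]
      nlinarith
    exact one_le_mul_of_one_le_of_one_le h1 (by linarith)
  have htwice : 16640 / Δ ^ 2 * Q = 2 * (8320 / Δ ^ 2 * Q) := by ring
  refine ⟨exists_nastySampleComplexity_eq (hlearn _ (Nat.le_ceil _)) ?_, fun n hn => ?_⟩
  · have := Nat.ceil_lt_add_one (zero_le_one.trans hone)
    linarith
  · exact hlearn n (by linarith)
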